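/- Let $A$ and $B$ be finite-dimensional quantum systems. For $\gamma\neq 1$ write $\gamma'=\frac{\gamma}{\gamma-1}$, and let $\log$ be the logarithm to base $2$. For positive semidefinite $\rho,\sigma$ write $\sigma\gg\rho$ if $\ker\sigma\subseteq\ker\rho$, and $\rho\perp\sigma$ if their supports are orthogonal. For a density matrix $\rho$, a positive semidefinite $\sigma$ and $\alpha\in(0,1)\cup(1,\infty)$ the (sandwiched) Rényi divergence is $$D_\alpha(\rho\|\sigma)=\frac{1}{\alpha-1}\log\operatorname{tr}\left[\left(\sigma^{\frac{1-\alpha}{2\alpha}}\rho\,\sigma^{\frac{1-\alpha}{2\alpha}}\right)^{\alpha}\right]\quad\text{if }\rho\not\perp\sigma\text{ and }(\sigma\gg\rho\text{ or }\alpha<1),$$ and $D_\alpha(\rho\|\sigma)=\infty$ otherwise, where negative powers are taken on the support (pseudoinverse). For $\alpha=1$ put $D_1(\rho\|\sigma)=\operatorname{tr}[\rho(\log\rho-\log\sigma)]$ if $\sigma\gg\rho$, with the convention $0\log 0=0$, and $D_1(\rho\|\sigma)=\infty$ otherwise. Put $H_\alpha(\rho_{AB}\|\tau_B)=-D_\alpha(\rho_{AB}\|\mathrm{id}_A\otimes\tau_B)$,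 and let $\rho_A=\operatorname{tr}_B\rho_{AB}$. **Theorem.** Let $\alpha,\beta\ge\frac12$ and $\gamma\in\mathbb R\setminus\{0,1\}$ satisfy $$\alpha\beta\gamma-2\beta\gamma-\alpha+\beta+\gamma=0$$ (for $\alpha,\beta\ne1$ this says $\alpha'=\beta'+\gamma'$). Let $\rho_{AB}$ be a density matrix on $AB$, $\sigma_A$ a strictly positive matrix on $A$ and $\tau_B$ a positive semidefinite matrix on $B$, and assume that either $\alpha<1$ and $\beta<1$, or $\mathrm{id}_A\otimes\tau_B\gg\rho_{AB}$. If $\frac1\beta+\frac1\gamma\le2$, then $$-H_\alpha(\rho_{AB}\|\tau_B)\le D_\beta(\rho_{AB}\|\sigma_A\otimes\tau_B)+\log\left(\operatorname{tr}\rho_A\sigma_A^{1/\gamma'}\right)^{\gamma'}.$$ If $\frac1\beta+\frac1\gamma\ge2$, then $$-H_\alpha(\rho_{AB}\|\tau_B)\ge D_\beta(\rho_{AB}\|\sigma_A\otimes\tau_B)+\log\left(\operatorname{tr}\rho_A\sigma_A^{1/\gamma'}\right)^{\gamma'}.$$ Both sides are read in $(-\infty,\infty]$. -/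

import Mathlib

open scoped Kronecker ComplexOrder

namespace Quantum

/-- A density matrix: a positive semidefinite matrix of unit trace. -/
def IsDensity {n : Type*} [Fintype n] (ρ : Matrix n n ℂ) : Prop :=
  ρ.PosSemidef ∧ ρ.trace = 1

/-- The power `X ^ r` of a positive semidefinite matrix with a real exponent `r ≠ 0`, by functional
calculus: an eigenvalue `x > 0` becomes `x ^ r` and an eigenvalue `0` stays `0`, so that negative
powers are powers of the pseudoinverse. -/
noncomputable def mpow {n : Type*} [Fintype n] [DecidableEq n] (X : Matrix n n ℂ) (r : ℝ) :
    Matrix n n ℂ :=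
  cfc (fun x : ℝ => x ^ r) X

/-- The base-two logarithm of a positive semidefinite matrix by functional calculus, with the
convention that an eigenvalue `0` is sent to `0` (so that `0 log 0 = 0`). -/
noncomputable def mlog {n : Type*} [Fintype n] [DecidableEq n] (X : Matrix n n ℂ) :
    Matrix n n ℂ :=
  cfc (fun x : ℝ => Real.logb 2 x) X

/-- `σ ≫ ρ`: the kernel of `σ` is contained in the kernel of `ρ`. -/
def Dominates {n : Type*} [Fintype n] (σ ρ : Matrix n n ℂ) : Prop :=
  ∀ v : n → ℂ, σ.mulVec v = 0 → ρ.mulVec v = 0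

/-- `ρ ⊥ σ` for positive semidefinite matrices: their supports are orthogonal. -/
def Perp {n : Type*} [Fintype n] (ρ σ : Matrix n n ℂ) : Prop :=
  ρ * σ = 0

/-- The partial trace over the second subsystem. -/
def partialTraceRight {a b : Type*} [Fintype b] (ρ : Matrix (a × b) (a × b) ℂ) : Matrix a a ℂ :=
  Matrix.of fun i j => ∑ k, ρ (i, k) (j, k)

/-- `α' = α / (α - 1)`, so that `1 / α + 1 / α' = 1` (for `α ≠ 0, 1`). -/
noncomputable def conj (α : ℝ) : ℝ := α / (α - 1)

open Classical in
/-- The quantum relative entropy `tr ρ (log ρ - log σ)`, which is `∞` unless `σ ≫ ρ`. -/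
noncomputable def relEntropy {n : Type*} [Fintype n] [DecidableEq n] (ρ σ : Matrix n n ℂ) : EReal :=
  if Dominates σ ρ then (((ρ * (mlog ρ - mlog σ)).trace.re : ℝ) : EReal) else ⊤

open Classical in
/-- The (sandwiched) quantum Rényi divergence `D_α(ρ‖σ)` of order `α > 0`; at `α = 1` it is its
limit, the quantum relative entropy. -/
noncomputable def renyiDiv {n : Type*} [Fintype n] [DecidableEq n] (α : ℝ) (ρ σ : Matrix n n ℂ) :
    EReal :=
  if α = 1 then relEntropy ρ σ
  else if ¬ Perp ρ σ ∧ (Dominates σ ρ ∨ α < 1) then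
    ((1 / (α - 1) * Real.logb 2
      (mpow (mpow σ ((1 - α) / (2 * α)) * ρ * mpow σ ((1 - α) / (2 * α))) α).trace.re : ℝ) : EReal)
  else ⊤

/-- The generalised conditional Rényi entropy `H_α(ρ_AB‖τ_B) = -D_α(ρ_AB‖1_A ⊗ τ_B)`. -/
noncomputable def condRenyi {a b : Type*} [Fintype a] [Fintype b] [DecidableEq a] [DecidableEq b]
    (α : ℝ) (ρ : Matrix (a × b) (a × b) ℂ) (τ : Matrix b b ℂ) : EReal :=
  -renyiDiv α ρ ((1 : Matrix a a ℂ) ⊗ₖ τ)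

end Quantum

/-!
Put `x = 1 - 1 / α`, `y = 1 - 1 / β`, `z = 1 - 1 / γ`, so that `1 / x = 1 / y + 1 / z`. Away from
order one the three quantities of the chain rule are `1 / x`, `1 / y` and `1 / z` times the
logarithms of the squared Schatten norms of `N ρ^{1/2}`, of orders `2α`, `2β` and `2`, for the
weights `N = τ^{-x/2}`, `(σ ⊗ τ)^{-y/2}` and `σ^{z/2}`. The exponents of `σ` and of `τ` and the
reciprocal `1 - x`, `1 - y`, `1` of the (halved) order are affine functions along one line, so the
three norms belong to one family to which complex interpolation applies: the logarithm of the norm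
is convex along the line. Since `α, β ≥ 1/2`, all orders are at least one and these are true norms.
Which of the three points lies between the other two depends on the signs of `y`, `z` and `y + z`;
in each case convexity, divided by the appropriate sign, is the asserted inequality
(`chainRule_diagConj`).

The interpolation theorem `powTrace_interpolation` is Stein's argument: the norm of the intermediate
matrix is a trace pairing with an explicit dual element, both factors are extended to analytic
functions on a strip, and the Hadamard three lines theorem is applied. On vertical lines the
imaginary powers are only phases, and the pairing is bounded by Hölder's inequality for the trace
(`norm_trace_le`), which for diagonalized factors is Hölder's inequality with doubly substochastic
weights.

The kernel of `τ` is handled by a projection `e` onto its support. If `1 ⊗ τ ≫ ρ` this projection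
changes nothing. Otherwise `α, β < 1`, the weight `σ^{z/2}` is then never the intermediate one, and
projecting it can only decrease its norm, which is the direction needed.

At `α = 1` the hypothesis forces `β = 1`, the relative entropies differ by the expectation of
`log σ`, and the claim is Jensen's inequality (`mul_sum_logb_le`).
-/

namespace Quantum

open Matrix

/-! ### Functional calculus in an eigenbasis -/

section SpectralForm

variable {n : Type*} [Fintype n] [DecidableEq n]

/-- The matrix `U diag(d) U*`, for a real vector `d`. With `U` unitary this is the Hermitian matrix
with eigenvalues `d` and eigenvectors the columns of `U`. -/
noncomputable def diagConj (U : Matrix n n ℂ) (d : n → ℝ) : Matrix n n ℂ :=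
  U * diagonal (fun i => (d i : ℂ)) * Uᴴ

theorem conjTranspose_mul_of_unitary {U : Matrix n n ℂ} (hU : U ∈ unitaryGroup n ℂ) :
    Uᴴ * U = 1 := (mem_unitaryGroup_iff').1 hU

theorem mul_conjTranspose_of_unitary {U : Matrix n n ℂ} (hU : U ∈ unitaryGroup n ℂ) :
    U * Uᴴ = 1 := (mem_unitaryGroup_iff).1 hU

theorem conjTranspose_mem_unitary {U : Matrix n n ℂ} (hU : U ∈ unitaryGroup n ℂ) :
    Uᴴ ∈ unitaryGroup n ℂ := Unitary.star_mem hU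

theorem diagConj_mul {U : Matrix n n ℂ} (hU : U ∈ unitaryGroup n ℂ) (d e : n → ℝ) :
    diagConj U d * diagConj U e = diagConj U (fun i => d i * e i) := by
  simp only [diagConj]
  calc _ = U * diagonal (fun i => (d i : ℂ)) * (Uᴴ * U) * diagonal (fun i => (e i : ℂ)) * Uᴴ := by
        noncomm_ring
    _ = _ := by
        rw [conjTranspose_mul_of_unitary hU, mul_one, mul_assoc U, diagonal_mul_diagonal]
        simp

theorem diagConj_conjTranspose (U : Matrix n n ℂ) (d : n → ℝ) :
    (diagConj U d)ᴴ = diagConj U d := by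
  simp only [diagConj, conjTranspose_mul, conjTranspose_conjTranspose, diagonal_conjTranspose,
    mul_assoc]
  congr
  ext i
  simp

theorem trace_mul_diagConj (ρ U : Matrix n n ℂ) (d : n → ℝ) :
    (ρ * diagConj U d).trace.re = ∑ i, ((Uᴴ * ρ * U) i i).re * d i := by
  have h : (ρ * diagConj U d).trace = (Uᴴ * ρ * U * diagonal (fun i => (d i : ℂ))).trace := by
    rw [diagConj, ← mul_assoc, trace_mul_comm]
    simp only [mul_assoc]
  rw [h, trace, Complex.re_sum]
  refine Finset.sum_congr rfl fun i _ => ?_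
  simp [mul_diagonal]

theorem trace_diagConj {U : Matrix n n ℂ} (hU : U ∈ unitaryGroup n ℂ) (d : n → ℝ) :
    (diagConj U d).trace.re = ∑ i, d i := by
  have := trace_mul_diagConj 1 U d
  rw [one_mul, mul_one, conjTranspose_mul_of_unitary hU] at this
  simpa using this

/-- The real functional calculus of `U diag(d) U*` acts on the vector `d`. -/
theorem cfc_diagConj {U : Matrix n n ℂ} (hU : U ∈ unitaryGroup n ℂ) (d : n → ℝ) (f : ℝ → ℝ) :
    cfc f (diagConj U d) = diagConj U (fun i => f (d i)) := by
  let φ : (n → ℝ) →ₐ[ℝ] Matrix n n ℂ := AlgHom.ofLinearMap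
    { toFun := diagConj U
      map_add' := fun x y => by
        simp only [diagConj, Pi.add_apply, Complex.ofReal_add, ← diagonal_add, mul_add, add_mul]
      map_smul' := fun r x => by
        have : diagonal (fun i => (((r • x) i : ℝ) : ℂ)) =
            r • diagonal (fun i => (x i : ℂ)) := by
          rw [← diagonal_smul]; congr 1; ext i; simp
        simp only [diagConj, this, mul_smul_comm, smul_mul_assoc, RingHom.id_apply] }
    (show diagConj U (fun _ => 1) = 1 by simp [diagConj, mul_conjTranspose_of_unitary hU])
    (fun x y => (diagConj_mul hU x y).symm)
  have hφ : ∀ x, φ x = diagConj U x := fun _ => rfl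
  have hsa : IsSelfAdjoint (diagConj U d) := diagConj_conjTranspose U d
  let p := Lagrange.interpolate (Finset.univ.image d) id f
  have hp : ∀ i, p.eval (d i) = f (d i) := fun i =>
    Lagrange.eval_interpolate_at_node (v := id) f (Set.injOn_id _)
      (Finset.mem_image_of_mem d (Finset.mem_univ i))
  have hspec : spectrum ℝ (diagConj U d) ⊆ Set.range d := by
    refine (AlgHom.spectrum_apply_subset φ d).trans ?_
    intro r hr
    by_contra h
    refine hr ?_
    rw [spectrum.mem_resolventSet_iff, Pi.isUnit_iff]
    intro i
    simp only [Pi.sub_apply, isUnit_iff_ne_zero]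
    intro h0
    exact h ⟨i, (sub_eq_zero.1 h0).symm⟩
  have h1 : cfc f (diagConj U d) = cfc (fun x => p.eval x) (diagConj U d) := by
    refine cfc_congr fun x hx => ?_
    obtain ⟨i, rfl⟩ := hspec hx
    exact (hp i).symm
  rw [h1, cfc_polynomial p _ hsa, ← hφ, Polynomial.aeval_algHom_apply, hφ]
  congr 1
  ext i
  rw [← hp i]
  have := Polynomial.aeval_algHom_apply (Pi.evalAlgHom ℝ (fun _ : n => ℝ) i) d p
  simp only [Pi.evalAlgHom_apply] at this
  rw [← this, Polynomial.coe_aeval_eq_eval]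

theorem mpow_diagConj {U : Matrix n n ℂ} (hU : U ∈ unitaryGroup n ℂ) (d : n → ℝ) (r : ℝ) :
    mpow (diagConj U d) r = diagConj U (fun i => d i ^ r) := cfc_diagConj hU d _

theorem mlog_diagConj {U : Matrix n n ℂ} (hU : U ∈ unitaryGroup n ℂ) (d : n → ℝ) :
    mlog (diagConj U d) = diagConj U (fun i => Real.logb 2 (d i)) := cfc_diagConj hU d _

theorem _root_.Matrix.IsHermitian.eq_diagConj {A : Matrix n n ℂ} (hA : A.IsHermitian) :
    A = diagConj hA.eigenvectorUnitary hA.eigenvalues := by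
  conv_lhs => rw [hA.spectral_theorem]
  rfl

theorem _root_.Matrix.PosSemidef.exists_eq_diagConj {A : Matrix n n ℂ} (hA : A.PosSemidef) :
    ∃ U ∈ unitaryGroup n ℂ, ∃ d : n → ℝ, (∀ i, 0 ≤ d i) ∧ A = diagConj U d :=
  ⟨_, hA.1.eigenvectorUnitary.2, _, hA.eigenvalues_nonneg, hA.1.eq_diagConj⟩

theorem _root_.Matrix.PosDef.exists_eq_diagConj {A : Matrix n n ℂ} (hA : A.PosDef) :
    ∃ U ∈ unitaryGroup n ℂ, ∃ d : n → ℝ, (∀ i, 0 < d i) ∧ A = diagConj U d :=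
  ⟨_, hA.1.eigenvectorUnitary.2, _, hA.eigenvalues_pos, hA.1.eq_diagConj⟩

theorem diagConj_kronecker {m : Type*} [Fintype m] [DecidableEq m] (U : Matrix n n ℂ)
    (V : Matrix m m ℂ) (d : n → ℝ) (e : m → ℝ) :
    diagConj U d ⊗ₖ diagConj V e = diagConj (U ⊗ₖ V) (fun p => d p.1 * e p.2) := by
  simp only [diagConj, conjTranspose_kronecker, mul_kronecker_mul, diagonal_kronecker_diagonal,
    Complex.ofReal_mul]

theorem one_eq_diagConj {U : Matrix n n ℂ} (hU : U ∈ unitaryGroup n ℂ) :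
    (1 : Matrix n n ℂ) = diagConj U (fun _ => 1) := by
  simp [diagConj, mul_conjTranspose_of_unitary hU]

end SpectralForm

/-! ### Hölder's inequality for the trace and polar decomposition -/

section Holder

variable {n : Type*} [Fintype n]

/-- Hölder's inequality with doubly substochastic weights. Both endpoints `x = 0` and `y = 0` are
included. -/
theorem sum_rpow_mul_rpow_le {p q : n → ℝ} (hp : ∀ i, 0 ≤ p i) (hq : ∀ i, 0 ≤ q i) {x y : ℝ}
    (hx : 0 ≤ x) (hy : 0 ≤ y) (hxy : x + y = 1) {w : n → n → ℝ} (hw : ∀ i j, 0 ≤ w i j)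
    (hrow : ∀ i, ∑ j, w i j ≤ 1) (hcol : ∀ j, ∑ i, w i j ≤ 1) :
    ∑ i, ∑ j, w i j * (p i ^ x * q j ^ y) ≤ (∑ i, p i) ^ x * (∑ j, q j) ^ y := by
  have hP : 0 ≤ ∑ i, p i := Finset.sum_nonneg fun i _ => hp i
  have hQ : 0 ≤ ∑ i, q i := Finset.sum_nonneg fun i _ => hq i
  -- For positive upper bounds of the two sums this is the weighted AM-GM inequality.
  have key : ∀ P Q : ℝ, 0 < P → 0 < Q → ∑ i, p i ≤ P → ∑ i, q i ≤ Q →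
      ∑ i, ∑ j, w i j * (p i ^ x * q j ^ y) ≤ P ^ x * Q ^ y := by
    intro P Q hP hQ hpP hqQ
    have hPQ : 0 < P ^ x * Q ^ y := by positivity
    have h1 : ∀ i j, w i j * (p i ^ x * q j ^ y) ≤
        P ^ x * Q ^ y * (x / P * (w i j * p i) + y / Q * (w i j * q j)) := by
      intro i j
      have := Real.geom_mean_le_arith_mean2_weighted hx hy (div_nonneg (hp i) hP.le)
        (div_nonneg (hq j) hQ.le) hxy
      rw [Real.div_rpow (hp i) hP.le, Real.div_rpow (hq j) hQ.le, div_mul_div_comm,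
        div_le_iff₀ hPQ] at this
      calc _ ≤ w i j * ((x * (p i / P) + y * (q j / Q)) * (P ^ x * Q ^ y)) :=
            mul_le_mul_of_nonneg_left this (hw i j)
        _ = _ := by ring
    have h2 : ∑ i, ∑ j, w i j * p i ≤ P := by
      refine le_trans (Finset.sum_le_sum fun i _ => ?_) hpP
      rw [← Finset.sum_mul]
      exact mul_le_of_le_one_left (hp i) (hrow i)
    have h3 : ∑ i, ∑ j, w i j * q j ≤ Q := by
      rw [Finset.sum_comm]
      refine le_trans (Finset.sum_le_sum fun i _ => ?_) hqQ
      rw [← Finset.sum_mul]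
      exact mul_le_of_le_one_left (hq i) (hcol i)
    calc _ ≤ ∑ i, ∑ j, P ^ x * Q ^ y * (x / P * (w i j * p i) + y / Q * (w i j * q j)) :=
          Finset.sum_le_sum fun i _ => Finset.sum_le_sum fun j _ => h1 i j
      _ = P ^ x * Q ^ y *
          (x / P * ∑ i, ∑ j, w i j * p i + y / Q * ∑ i, ∑ j, w i j * q j) := by
          simp only [Finset.mul_sum, ← Finset.sum_add_distrib]
      _ ≤ P ^ x * Q ^ y * (x / P * P + y / Q * Q) := by gcongr
      _ = P ^ x * Q ^ y := by
          rw [div_mul_cancel₀ _ hP.ne', div_mul_cancel₀ _ hQ.ne', hxy, mul_one]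
  have hc : Continuous fun ε : ℝ => (∑ i, p i + ε) ^ x * (∑ j, q j + ε) ^ y :=
    ((continuous_const.add continuous_id).rpow_const fun _ => Or.inr hx).mul
      ((continuous_const.add continuous_id).rpow_const fun _ => Or.inr hy)
  have ht := (hc.tendsto 0).mono_left (nhdsWithin_le_nhds (s := Set.Ioi 0))
  simp only [add_zero] at ht
  refine ge_of_tendsto ht ?_
  filter_upwards [self_mem_nhdsWithin] with ε hε
  have hε : 0 < ε := hε
  exact key _ _ (by linarith) (by linarith) (by linarith) (by linarith)

open scoped Matrix.Norms.L2Operator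

variable [DecidableEq n]

theorem sum_col_sq_le_one {C : Matrix n n ℂ} (hC : ‖C‖ ≤ 1) (j : n) : ∑ i, ‖C i j‖ ^ 2 ≤ 1 := by
  have h := l2_opNorm_mulVec C (EuclideanSpace.single j 1)
  have h1 : ‖(EuclideanSpace.equiv n ℂ).symm (C *ᵥ EuclideanSpace.single j 1)‖ ≤ 1 := by
    refine h.trans ?_
    simpa using hC
  have h2 := pow_le_one₀ (norm_nonneg _) h1 (n := 2)
  rw [EuclideanSpace.norm_sq_eq] at h2
  simpa using h2

theorem sum_row_sq_le_one {C : Matrix n n ℂ} (hC : ‖C‖ ≤ 1) (i : n) : ∑ j, ‖C i j‖ ^ 2 ≤ 1 := by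
  have := sum_col_sq_le_one (C := Cᴴ) (by rwa [l2_opNorm_conjTranspose]) i
  simpa using this

/-- Hölder's inequality for the trace, with the two factors diagonalized and the changes of basis
absorbed into the contractions `C` and `D`. -/
theorem norm_trace_le {C D : Matrix n n ℂ} (hC : ‖C‖ ≤ 1) (hD : ‖D‖ ≤ 1) {p q : n → ℝ}
    (hp : ∀ i, 0 ≤ p i) (hq : ∀ i, 0 ≤ q i) {x y : ℝ}
    (hx : 0 ≤ x) (hy : 0 ≤ y) (hxy : x + y = 1) :
    ‖(diagonal (fun i => ((p i ^ x : ℝ) : ℂ)) * C * diagonal (fun i => ((q i ^ y : ℝ) : ℂ)) *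
      D).trace‖ ≤ (∑ i, p i) ^ x * (∑ j, q j) ^ y := by
  have hmix : ∀ f g : n → ℂ, ∑ i, ‖f i‖ ^ 2 ≤ 1 → ∑ i, ‖g i‖ ^ 2 ≤ 1 →
      ∑ i, ‖f i‖ * ‖g i‖ ≤ 1 := by
    intro f g hf hg
    have : ∑ i, ‖f i‖ * ‖g i‖ ≤ ∑ i, (‖f i‖ ^ 2 + ‖g i‖ ^ 2) / 2 :=
      Finset.sum_le_sum fun i _ => by nlinarith [sq_nonneg (‖f i‖ - ‖g i‖)]
    rw [← Finset.sum_div, Finset.sum_add_distrib] at this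
    linarith
  refine le_trans ?_ (sum_rpow_mul_rpow_le hp hq hx hy hxy (w := fun i j => ‖C i j‖ * ‖D j i‖)
    (fun i j => by positivity)
    (fun i => hmix (fun j => C i j) (fun j => D j i) (sum_row_sq_le_one hC i)
      (sum_col_sq_le_one hD i))
    (fun j => hmix (fun i => C i j) (fun i => D j i) (sum_col_sq_le_one hC j)
      (sum_row_sq_le_one hD j)))
  rw [trace]
  refine (norm_sum_le _ _).trans (Finset.sum_le_sum fun i _ => ?_)
  rw [diag_apply, mul_apply]
  refine (norm_sum_le _ _).trans (Finset.sum_le_sum fun j _ => ?_)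
  rw [mul_diagonal, diagonal_mul]
  simp only [norm_mul, Complex.norm_real, Real.norm_eq_abs,
    abs_of_nonneg (Real.rpow_nonneg (hp i) x), abs_of_nonneg (Real.rpow_nonneg (hq j) y)]
  apply le_of_eq
  ring

theorem norm_unitary_le_one {U : Matrix n n ℂ} (hU : U ∈ unitaryGroup n ℂ) : ‖U‖ ≤ 1 := by
  have h : ‖U‖ * ‖U‖ = ‖(1 : Matrix n n ℂ)‖ := by
    rw [← l2_opNorm_conjTranspose_mul_self, conjTranspose_mul_of_unitary hU]
  have h1 : ‖(1 : Matrix n n ℂ)‖ ≤ 1 := by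
    rw [← diagonal_one, l2_opNorm_diagonal]
    exact (pi_norm_le_iff_of_nonneg zero_le_one).2 fun i => by simp
  nlinarith [norm_nonneg U]

theorem norm_mul_le_one {C D : Matrix n n ℂ} (hC : ‖C‖ ≤ 1) (hD : ‖D‖ ≤ 1) : ‖C * D‖ ≤ 1 :=
  (l2_opNorm_mul C D).trans (mul_le_one₀ hC (norm_nonneg _) hD)

theorem norm_diagonal_le_one {φ : n → ℂ} (hφ : ∀ i, ‖φ i‖ ≤ 1) :
    ‖(diagonal φ : Matrix n n ℂ)‖ ≤ 1 := by
  rw [l2_opNorm_diagonal]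
  exact (pi_norm_le_iff_of_nonneg zero_le_one).2 hφ

/-- Polar decomposition in the eigenbasis of `X X*`: the rows of `V* X` are orthogonal, and
normalizing those that do not vanish gives the partial isometry. -/
theorem exists_polar {X V : Matrix n n ℂ} (hV : V ∈ unitaryGroup n ℂ) {g : n → ℝ}
    (hg : ∀ i, 0 ≤ g i) (hX : X * Xᴴ = diagConj V g) :
    ∃ C : Matrix n n ℂ, ‖C‖ ≤ 1 ∧ X = V * diagonal (fun i => ((√(g i) : ℝ) : ℂ)) * C ∧
      C * Cᴴ = diagonal (fun i => if g i = 0 then 0 else 1) := by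
  let B := Vᴴ * X
  have hB : B * Bᴴ = diagonal (fun i => (g i : ℂ)) := by
    calc B * Bᴴ = Vᴴ * (X * Xᴴ) * V := by
          simp only [B, conjTranspose_mul, conjTranspose_conjTranspose, mul_assoc]
      _ = (Vᴴ * V) * diagonal (fun i => (g i : ℂ)) * (Vᴴ * V) := by
          rw [hX, diagConj]; noncomm_ring
      _ = _ := by rw [conjTranspose_mul_of_unitary hV, one_mul, mul_one]
  have hrow : ∀ i, g i = 0 → ∀ j, B i j = 0 := by
    intro i hi j
    have h := congr_fun (congr_fun hB i) i
    rw [diagonal_apply_eq, hi, mul_apply] at h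
    simp only [conjTranspose_apply, Complex.ofReal_zero] at h
    have h' : ∑ k, ‖B i k‖ ^ 2 = 0 := by
      have : ((∑ k, ‖B i k‖ ^ 2 : ℝ) : ℂ) = 0 := by
        rw [← h]
        push_cast
        refine Finset.sum_congr rfl fun k _ => ?_
        rw [← Complex.mul_conj']; rfl
      exact_mod_cast this
    have := (Finset.sum_eq_zero_iff_of_nonneg (fun k _ => by positivity)).1 h' j
      (Finset.mem_univ j)
    simpa using this
  let S := diagonal (fun i => (((√(g i))⁻¹ : ℝ) : ℂ))
  have hCC : (S * B) * (S * B)ᴴ = diagonal (fun i => if g i = 0 then 0 else 1) := by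
    have hS : Sᴴ = S := by
      simp only [S, diagonal_conjTranspose]; congr 1; ext i; simp
    calc (S * B) * (S * B)ᴴ = S * (B * Bᴴ) * S := by
          rw [conjTranspose_mul, hS]; simp only [mul_assoc]
      _ = _ := by
          rw [hB]
          simp only [S, diagonal_mul_diagonal]
          congr 1
          ext i
          split_ifs with h
          · simp [h]
          · have h0 : 0 < g i := lt_of_le_of_ne (hg i) (Ne.symm h)
            have : (√(g i))⁻¹ * g i * (√(g i))⁻¹ = 1 := by
              have h2 : 0 < √(g i) := Real.sqrt_pos.2 h0
              field_simp
              exact (Real.sq_sqrt h0.le).symm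
            exact_mod_cast this
  refine ⟨S * B, ?_, ?_, hCC⟩
  · have h : ‖S * B‖ * ‖S * B‖ ≤ 1 := by
      rw [← l2_opNorm_conjTranspose (S * B), ← l2_opNorm_conjTranspose_mul_self,
        conjTranspose_conjTranspose, hCC]
      exact norm_diagonal_le_one fun i => by split_ifs <;> simp
    nlinarith [norm_nonneg (S * B)]
  · have : diagonal (fun i => ((√(g i) : ℝ) : ℂ)) * (S * B) = B := by
      ext i j
      rw [diagonal_mul, diagonal_mul]
      rcases (hg i).eq_or_lt with h | h
      · rw [hrow i h.symm]; simp
      · have h2 : ((√(g i) : ℝ) : ℂ) ≠ 0 := by exact_mod_cast (Real.sqrt_pos.2 h).ne'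
        push_cast
        rw [mul_inv_cancel_left₀ h2]
    rw [mul_assoc, this]
    simp only [B]
    rw [← mul_assoc, mul_conjTranspose_of_unitary hV, one_mul]

end Holder

/-! ### The three lines theorem for exponential sums -/

section ThreeLines

open Complex.HadamardThreeLines in
/-- The three lines theorem for an exponential sum with real frequencies. -/
theorem norm_expSum_le {ι : Type*} [Fintype ι] (c : ι → ℂ) (a b : ι → ℝ) {B₀ B₁ θ : ℝ}
    (hθ0 : 0 ≤ θ) (hθ1 : θ ≤ 1)
    (h0 : ∀ y : ℝ, ‖∑ k, c k * Complex.exp (a k + (0 + y * Complex.I) * b k)‖ ≤ B₀)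
    (h1 : ∀ y : ℝ, ‖∑ k, c k * Complex.exp (a k + (1 + y * Complex.I) * b k)‖ ≤ B₁) :
    ‖∑ k, c k * Complex.exp (a k + θ * b k)‖ ≤ B₀ ^ (1 - θ) * B₁ ^ θ := by
  let f : ℂ → ℂ := fun z => ∑ k, c k * Complex.exp (a k + z * b k)
  have hd : Differentiable ℂ f := by fun_prop
  have hz : ∀ z : ℂ, z = (z.re : ℂ) + z.im * Complex.I := fun z => (Complex.re_add_im z).symm
  have := norm_le_interp_of_mem_verticalClosedStrip₀₁' f (z := (θ : ℂ)) (a := B₀) (b := B₁)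
    ⟨by simpa using hθ0, by simpa using hθ1⟩ hd.diffContOnCl ?_ ?_ ?_
  · simpa using this
  · refine ⟨∑ k, ‖c k‖ * Real.exp (|a k| + |b k|), ?_⟩
    rintro _ ⟨z, hz, rfl⟩
    have hz0 : 0 ≤ z.re := hz.1
    have hz1 : z.re ≤ 1 := hz.2
    refine (norm_sum_le _ _).trans (Finset.sum_le_sum fun k _ => ?_)
    rw [norm_mul, Complex.norm_exp]
    gcongr
    simp only [Complex.add_re, Complex.ofReal_re, Complex.mul_re, Complex.ofReal_im, mul_zero,
      sub_zero]
    have : |z.re * b k| ≤ |b k| := by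
      rw [abs_mul, abs_of_nonneg hz0]; exact mul_le_of_le_one_left (abs_nonneg _) hz1
    linarith [le_abs_self (a k), le_abs_self (z.re * b k)]
  · intro z hzr
    have hzr : z.re = 0 := hzr
    have := h0 z.im
    have e : z = 0 + z.im * Complex.I := by
      conv_lhs => rw [hz z, hzr]
      simp
    rwa [← e] at this
  · intro z hzr
    have hzr : z.re = 1 := hzr
    have := h1 z.im
    have e : z = 1 + z.im * Complex.I := by
      conv_lhs => rw [hz z, hzr]
      simp
    rwa [← e] at this

end ThreeLines

/-! ### Interpolation of weighted Schatten norms -/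

section Interpolation

variable {n : Type*} [Fintype n] [DecidableEq n]

/-- The trace `tr X^α`, a real number for Hermitian `X`. For `X = Z Z*` it is the `2α`-th power of
the Schatten `2α`-norm of `Z`. -/
noncomputable def powTrace (α : ℝ) (X : Matrix n n ℂ) : ℝ := (mpow X α).trace.re

theorem powTrace_diagConj {U : Matrix n n ℂ} (hU : U ∈ unitaryGroup n ℂ) (d : n → ℝ) (α : ℝ) :
    powTrace α (diagConj U d) = ∑ i, d i ^ α := by
  rw [powTrace, mpow_diagConj hU, trace_diagConj hU]

theorem powTrace_nonneg {X : Matrix n n ℂ} (hX : X.PosSemidef) (α : ℝ) : 0 ≤ powTrace α X := by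
  obtain ⟨U, hU, d, hd, rfl⟩ := hX.exists_eq_diagConj
  rw [powTrace_diagConj hU]
  exact Finset.sum_nonneg fun i _ => Real.rpow_nonneg (hd i) _

theorem eq_zero_of_powTrace_eq_zero {X : Matrix n n ℂ} (hX : X.PosSemidef) {α : ℝ}
    (h : powTrace α X = 0) : X = 0 := by
  obtain ⟨U, hU, d, hd, rfl⟩ := hX.exists_eq_diagConj
  rw [powTrace_diagConj hU,
    Finset.sum_eq_zero_iff_of_nonneg fun i _ => Real.rpow_nonneg (hd i) _] at h
  have hd0 : ∀ i, d i = 0 := fun i => by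
    by_contra hi
    exact (Real.rpow_pos_of_pos (lt_of_le_of_ne (hd i) (Ne.symm hi)) α).ne'
      (h i (Finset.mem_univ i))
  have : d = fun _ => 0 := funext hd0
  simp [diagConj, this]

open scoped Matrix.Norms.L2Operator

/-- The bound on a vertical line: Hölder's inequality for `Z = diagConj U d * M`, whose Schatten
norm does not see the phases `φ` and `ψ` of the imaginary powers. -/
theorem norm_trace_phase_le {U V M C : Matrix n n ℂ} (hU : U ∈ unitaryGroup n ℂ)
    (hV : V ∈ unitaryGroup n ℂ) (hC : ‖C‖ ≤ 1) (d q : n → ℝ) (hq : ∀ i, 0 ≤ q i) (φ ψ : n → ℂ)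
    (hφ : ∀ i, ‖φ i‖ ≤ 1) (hψ : ∀ i, ‖ψ i‖ ≤ 1) {α : ℝ} (hα : 1 / 2 ≤ α) :
    ‖(diagonal (fun i => φ i * d i) * (Uᴴ * M * Cᴴ) *
        diagonal (fun j => ((q j ^ (1 - 1 / (2 * α)) : ℝ) : ℂ) * ψ j) * (Vᴴ * U)).trace‖ ≤
      powTrace α (diagConj U d * (M * Mᴴ) * diagConj U d) ^ (1 / (2 * α)) *
        (∑ j, q j) ^ (1 - 1 / (2 * α)) := by
  have hα0 : 0 < α := by linarith
  let X := diagConj U d * M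
  have hXX : X * Xᴴ = diagConj U d * (M * Mᴴ) * diagConj U d := by
    simp only [X, conjTranspose_mul, diagConj_conjTranspose, mul_assoc]
  obtain ⟨W, hW, g, hg, hXg⟩ := (posSemidef_self_mul_conjTranspose X).exists_eq_diagConj
  obtain ⟨D, hD, hXD, -⟩ := exists_polar hW hg hXg
  have hsqrt : ∀ i, √(g i) = (g i ^ α) ^ (1 / (2 * α)) := fun i => by
    rw [← Real.rpow_mul (hg i), Real.sqrt_eq_rpow]
    congr 1
    field_simp
  have hx : 0 ≤ 1 / (2 * α) := by positivity
  have hy : 0 ≤ 1 - 1 / (2 * α) := by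
    rw [sub_nonneg, div_le_one (by positivity)]; linarith
  have hmain := norm_trace_le (C := D * Cᴴ)
    (D := diagonal ψ * (Vᴴ * U) * diagonal φ * (Uᴴ * W))
    (norm_mul_le_one hD (by rwa [l2_opNorm_conjTranspose]))
    (norm_mul_le_one (norm_mul_le_one (norm_mul_le_one (norm_diagonal_le_one hψ)
      (norm_mul_le_one (norm_unitary_le_one (conjTranspose_mem_unitary hV))
        (norm_unitary_le_one hU))) (norm_diagonal_le_one hφ))
      (norm_mul_le_one (norm_unitary_le_one (conjTranspose_mem_unitary hU))
        (norm_unitary_le_one hW)))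
    (p := fun i => g i ^ α) (q := q) (fun i => Real.rpow_nonneg (hg i) _) hq hx hy (by ring)
  rw [← hXX, hXg, powTrace_diagConj hW]
  refine le_trans (le_of_eq ?_) hmain
  congr 1
  simp only [← hsqrt]
  have e1 : diagonal (fun i => φ i * (d i : ℂ)) = diagonal φ * diagonal (fun i => (d i : ℂ)) := by
    rw [diagonal_mul_diagonal]
  have e2 : diagonal (fun j => ((q j ^ (1 - 1 / (2 * α)) : ℝ) : ℂ) * ψ j) =
      diagonal (fun j => ((q j ^ (1 - 1 / (2 * α)) : ℝ) : ℂ)) * diagonal ψ := by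
    rw [diagonal_mul_diagonal]
  have e3 : diagonal (fun i => (d i : ℂ)) * (Uᴴ * M) =
      Uᴴ * (W * diagonal (fun i => ((√(g i) : ℝ) : ℂ)) * D) := by
    rw [← hXD]
    simp only [X, diagConj]
    simp only [← mul_assoc]
    rw [conjTranspose_mul_of_unitary hU, one_mul]
  calc _ = (diagonal φ * (diagonal (fun i => (d i : ℂ)) * (Uᴴ * M)) * Cᴴ *
        diagonal (fun j => ((q j ^ (1 - 1 / (2 * α)) : ℝ) : ℂ)) * diagonal ψ * (Vᴴ * U)).trace := by
        rw [e1, e2]; simp only [mul_assoc]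
    _ = ((diagonal φ * Uᴴ * W) * (diagonal (fun i => ((√(g i) : ℝ) : ℂ)) * D * Cᴴ *
        diagonal (fun j => ((q j ^ (1 - 1 / (2 * α)) : ℝ) : ℂ)) * diagonal ψ *
          (Vᴴ * U))).trace := by
        rw [e3]; simp only [mul_assoc]
    _ = _ := by
        rw [trace_mul_comm]; simp only [mul_assoc]

theorem trace_diagonal_mul_mul (k l : n → ℂ) (R S : Matrix n n ℂ) :
    (diagonal k * R * diagonal l * S).trace =
      ∑ p : n × n, k p.1 * R p.1 p.2 * l p.2 * S p.2 p.1 := by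
  rw [trace, Fintype.sum_prod_type]
  refine Finset.sum_congr rfl fun i _ => ?_
  rw [diag_apply, mul_apply]
  refine Finset.sum_congr rfl fun j _ => ?_
  rw [mul_diagonal, diagonal_mul]

/-- Stein interpolation for the Schatten norms of `N ρ^{1/2}`, where the weight `N` moves
log-linearly along a commuting family and the reciprocal of the order moves linearly. The factor `e`
is a fixed part of the weight, such as the projection onto a support. -/
theorem powTrace_interpolation {U ρ : Matrix n n ℂ} (hU : U ∈ unitaryGroup n ℂ)
    (hρ : ρ.PosSemidef) (e w₀ w₁ w : n → ℝ) {α₀ α₁ α θ : ℝ} (hα₀ : 1 / 2 ≤ α₀) (hα₁ : 1 / 2 ≤ α₁)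
    (hα : 0 < α) (hθ0 : 0 ≤ θ) (hθ1 : θ ≤ 1) (hαθ : 1 / α = (1 - θ) * (1 / α₀) + θ * (1 / α₁))
    (hw : ∀ i, w i = (1 - θ) * w₀ i + θ * w₁ i) {N₀ N₁ N : Matrix n n ℂ}
    (hN₀ : N₀ = diagConj U (fun i => e i * Real.exp (w₀ i)))
    (hN₁ : N₁ = diagConj U (fun i => e i * Real.exp (w₁ i)))
    (hN : N = diagConj U (fun i => e i * Real.exp (w i)))
    (hpos : 0 < powTrace α (N * ρ * N)) :
    powTrace α (N * ρ * N) ^ (1 / (2 * α)) ≤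
      (powTrace α₀ (N₀ * ρ * N₀) ^ (1 / (2 * α₀))) ^ (1 - θ) *
        (powTrace α₁ (N₁ * ρ * N₁) ^ (1 / (2 * α₁))) ^ θ := by
  obtain ⟨M, hM⟩ : ∃ M : Matrix n n ℂ, ρ = M * Mᴴ := by
    obtain ⟨W, hW, d, hd, rfl⟩ := hρ.exists_eq_diagConj
    refine ⟨diagConj W fun i => √(d i), ?_⟩
    rw [diagConj_conjTranspose, diagConj_mul hW]
    simp only [Real.mul_self_sqrt (hd _)]
  have hhalf : ∀ x : ℝ, 1 / (2 * x) = (1 / x) / 2 := fun x => by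
    rw [mul_comm, div_mul_eq_div_div]
  let Z := N * M
  have hNs : Nᴴ = N := by rw [hN]; exact diagConj_conjTranspose _ _
  have hZZ : Z * Zᴴ = N * ρ * N := by
    simp only [Z, conjTranspose_mul, hNs, hM, mul_assoc]
  obtain ⟨V, hV, g, hg, hZg⟩ := (posSemidef_self_mul_conjTranspose Z).exists_eq_diagConj
  obtain ⟨C, hC, hZC, hCC⟩ := exists_polar hV hg hZg
  have hT : powTrace α (N * ρ * N) = ∑ j, g j ^ α := by
    rw [← hZZ, hZg, powTrace_diagConj hV]
  set T := powTrace α (N * ρ * N) with hTdef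
  set S₀ := powTrace α₀ (N₀ * ρ * N₀) with hS₀
  set S₁ := powTrace α₁ (N₁ * ρ * N₁) with hS₁
  have hρnn : ∀ (N' : Matrix n n ℂ), N'ᴴ = N' → (N' * ρ * N').PosSemidef := fun N' h => by
    have := hρ.mul_mul_conjTranspose_same N'
    rwa [h] at this
  have hS₀nn : 0 ≤ S₀ := powTrace_nonneg (hρnn _ (by rw [hN₀]; exact diagConj_conjTranspose _ _)) _
  have hS₁nn : 0 ≤ S₁ := powTrace_nonneg (hρnn _ (by rw [hN₁]; exact diagConj_conjTranspose _ _)) _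
  -- The analytic family pairs `N(z) M` with the dual element `C* diag(g ^ (α (1 - 1 / p(z)))) V*`,
  -- where `1 / p(z)` runs linearly from `y₀` to `y₁`.
  let y₀ := 1 / (2 * α₀)
  let y₁ := 1 / (2 * α₁)
  let R := Uᴴ * M * Cᴴ
  let S := Vᴴ * U
  let χ : n → ℂ := fun j => if g j = 0 then 0 else 1
  let k : ℂ → n → ℂ := fun z i => e i * Complex.exp (w₀ i + z * (w₁ i - w₀ i : ℝ))
  let l : ℂ → n → ℂ := fun z j =>
    χ j * Complex.exp ((Real.log (g j) * (α * (1 - y₀)) : ℝ) +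
      z * (Real.log (g j) * (α * (y₀ - y₁)) : ℝ))
  let f : ℂ → ℂ := fun z => (diagonal (k z) * R * diagonal (l z) * S).trace
  have hf : ∀ z, f z = ∑ p : n × n, ((e p.1 : ℂ) * R p.1 p.2 * χ p.2 * S p.2 p.1) *
      Complex.exp (((w₀ p.1 + Real.log (g p.2) * (α * (1 - y₀)) : ℝ) : ℂ) +
        z * ((w₁ p.1 - w₀ p.1 + Real.log (g p.2) * (α * (y₀ - y₁)) : ℝ) : ℂ)) := by
    intro z
    simp only [f]
    rw [trace_diagonal_mul_mul]
    refine Finset.sum_congr rfl fun p _ => ?_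
    have : Complex.exp (((w₀ p.1 + Real.log (g p.2) * (α * (1 - y₀)) : ℝ) : ℂ) +
        z * ((w₁ p.1 - w₀ p.1 + Real.log (g p.2) * (α * (y₀ - y₁)) : ℝ) : ℂ)) =
        Complex.exp (w₀ p.1 + z * (w₁ p.1 - w₀ p.1 : ℝ)) *
        Complex.exp ((Real.log (g p.2) * (α * (1 - y₀)) : ℝ) +
          z * (Real.log (g p.2) * (α * (y₀ - y₁)) : ℝ)) := by
      rw [← Complex.exp_add]
      congr 1
      push_cast
      ring
    rw [this]
    simp only [k, l]
    ring
  have hgα : ∀ j, 0 ≤ g j ^ α := fun j => Real.rpow_nonneg (hg j) _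
  have hphase : ∀ x : ℝ, ‖Complex.exp (x * Complex.I)‖ ≤ 1 := fun x =>
    (Complex.norm_exp_ofReal_mul_I x).le
  have hχ : ∀ (j : n) (u x s : ℝ), s = Real.log (g j) * (α * u) →
      χ j * Complex.exp (s + x * Complex.I) =
        (((g j ^ α) ^ u : ℝ) : ℂ) * (χ j * Complex.exp (x * Complex.I)) := by
    intro j u x s hs
    simp only [χ]
    split_ifs with h
    · simp
    · have h0 : 0 < g j := lt_of_le_of_ne (hg j) (Ne.symm h)
      rw [← Real.rpow_mul h0.le, Real.rpow_def_of_pos h0, ← hs, Complex.exp_add,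
        Complex.ofReal_exp]
      ring
  have hχ1 : ∀ (j : n) (x : ℝ), ‖χ j * Complex.exp (x * Complex.I)‖ ≤ 1 := by
    intro j x
    simp only [χ]
    split_ifs <;> simp
  have hline : ∀ (s y α' : ℝ) (w' : n → ℝ) (N' : Matrix n n ℂ), 1 / 2 ≤ α' →
      (∀ i, w' i = w₀ i + s * (w₁ i - w₀ i)) →
      1 / (2 * α') = y₀ + s * (y₁ - y₀) →
      N' = diagConj U (fun i => e i * Real.exp (w' i)) →
      ‖f (s + y * Complex.I)‖ ≤
        powTrace α' (N' * ρ * N') ^ (1 / (2 * α')) * T ^ (1 - 1 / (2 * α')) := by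
    intro s y α' w' N' hα' hw' hα's hN'
    have hb := norm_trace_phase_le (M := M) hU hV hC (fun i => e i * Real.exp (w' i))
      (fun j => g j ^ α) hgα
      (fun i => Complex.exp ((y * (w₁ i - w₀ i) : ℝ) * Complex.I))
      (fun j => χ j * Complex.exp ((y * (Real.log (g j) * (α * (y₀ - y₁))) : ℝ) * Complex.I))
      (fun i => hphase _) (fun j => hχ1 j _) hα'
    rw [← hN', ← hM, ← hT] at hb
    refine le_trans (le_of_eq ?_) hb
    simp only [f]
    congr 5
    · congr 1
      ext i
      simp only [k]
      rw [hw' i]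
      push_cast
      rw [mul_left_comm, ← Complex.exp_add]
      congr 2
      ring
    · ext j
      rw [← hχ j _ _ (Real.log (g j) * (α * (1 - 1 / (2 * α')))) rfl]
      simp only [l]
      rw [hα's]
      congr 2
      push_cast
      ring
  have hfθ : f θ = T := by
    have hαθ' : 1 / (2 * α) = y₀ + θ * (y₁ - y₀) := by
      simp only [y₀, y₁, hhalf]
      rw [hαθ]
      ring
    have hk : U * diagonal (k θ) * Uᴴ = N := by
      rw [hN, diagConj]
      congr 3
      ext i
      simp only [k]
      rw [hw i]
      push_cast
      congr 2
      ring
    have hl : ∀ j, ((√(g j) : ℝ) : ℂ) * χ j * l θ j = ((g j ^ α : ℝ) : ℂ) := by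
      intro j
      simp only [l]
      by_cases h : g j = 0
      · simp [h, χ, Real.zero_rpow hα.ne']
      · have h0 : 0 < g j := lt_of_le_of_ne (hg j) (Ne.symm h)
        have h1 : √(g j) * Real.exp (Real.log (g j) * (α * (1 - y₀)) +
            θ * (Real.log (g j) * (α * (y₀ - y₁)))) = g j ^ α := by
          rw [Real.sqrt_eq_rpow, Real.rpow_def_of_pos h0, Real.rpow_def_of_pos h0, ← Real.exp_add]
          congr 1
          have : α * (y₀ + θ * (y₁ - y₀)) = 1 / 2 := by rw [← hαθ']; field_simp
          linear_combination (-Real.log (g j)) * this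
        have h2 : χ j = 1 := by simp [χ, h]
        rw [h2, ← h1]
        push_cast
        ring
    calc f θ = (U * diagonal (k θ) * Uᴴ * M * Cᴴ * diagonal (l θ) * Vᴴ).trace := by
          simp only [f, R, S]
          rw [show U * diagonal (k θ) * Uᴴ * M * Cᴴ * diagonal (l θ) * Vᴴ =
            U * (diagonal (k θ) * Uᴴ * M * Cᴴ * diagonal (l θ) * Vᴴ) by simp only [mul_assoc],
            trace_mul_comm U]
          simp only [mul_assoc]
      _ = (V * diagonal (fun i => ((√(g i) : ℝ) : ℂ)) * (C * Cᴴ) * diagonal (l θ) * Vᴴ).trace := by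
          rw [hk, show N * M = V * diagonal (fun i => ((√(g i) : ℝ) : ℂ)) * C from hZC]
          simp only [mul_assoc]
      _ = (diagConj V (fun j => g j ^ α)).trace := by
          rw [hCC, mul_assoc V, mul_assoc V, diagonal_mul_diagonal, diagonal_mul_diagonal, diagConj]
          simp only [← hl]
          rfl
      _ = T := by
          rw [hT, diagConj, trace_mul_comm, ← mul_assoc, conjTranspose_mul_of_unitary hV, one_mul,
            trace_diagonal]
          push_cast
          rfl
  have h3 := norm_expSum_le
    (fun p : n × n => (e p.1 : ℂ) * R p.1 p.2 * χ p.2 * S p.2 p.1)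
    (fun p => w₀ p.1 + Real.log (g p.2) * (α * (1 - y₀)))
    (fun p => w₁ p.1 - w₀ p.1 + Real.log (g p.2) * (α * (y₀ - y₁))) hθ0 hθ1
    (B₀ := S₀ ^ (1 / (2 * α₀)) * T ^ (1 - 1 / (2 * α₀)))
    (B₁ := S₁ ^ (1 / (2 * α₁)) * T ^ (1 - 1 / (2 * α₁)))
    (fun y => by
      rw [← hf]
      have := hline 0 y α₀ w₀ N₀ hα₀ (by simp) (by simp [y₀]) hN₀
      simpa using this)
    (fun y => by
      rw [← hf]
      have := hline 1 y α₁ w₁ N₁ hα₁ (by simp) (by simp [y₁]) hN₁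
      simpa using this)
  rw [← hf, hfθ, Complex.norm_real, Real.norm_eq_abs, abs_of_pos hpos,
    Real.mul_rpow (Real.rpow_nonneg hS₀nn _) (Real.rpow_nonneg hpos.le _),
    Real.mul_rpow (Real.rpow_nonneg hS₁nn _) (Real.rpow_nonneg hpos.le _),
    ← Real.rpow_mul hpos.le, ← Real.rpow_mul hpos.le, mul_mul_mul_comm,
    ← Real.rpow_add hpos] at h3
  have hexp : (1 - 1 / (2 * α₀)) * (1 - θ) + (1 - 1 / (2 * α₁)) * θ = 1 - 1 / (2 * α) := by
    rw [hhalf, hhalf, hhalf, hαθ]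
    ring
  have hpos' : 0 < T ^ (1 - 1 / (2 * α)) := Real.rpow_pos_of_pos hpos _
  rw [hexp] at h3
  refine le_of_mul_le_mul_right ?_ hpos'
  rw [← Real.rpow_add hpos]
  calc T ^ (1 / (2 * α) + (1 - 1 / (2 * α))) = T := by
        rw [show 1 / (2 * α) + (1 - 1 / (2 * α)) = 1 by ring, Real.rpow_one]
    _ ≤ _ := h3

end Interpolation

/-! ### Logarithmic convexity -/

section LogConvexity

variable {n : Type*} [Fintype n] [DecidableEq n]

/-- `powTrace_interpolation` as a convexity statement for logarithms, with unnormalized weights. -/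
theorem logb_powTrace_interpolation {U ρ : Matrix n n ℂ} (hU : U ∈ unitaryGroup n ℂ)
    (hρ : ρ.PosSemidef) (e w₀ w₁ w : n → ℝ) {α₀ α₁ α l₀ l₁ : ℝ} (hα₀ : 1 / 2 ≤ α₀)
    (hα₁ : 1 / 2 ≤ α₁) (hα : 0 < α) (hl₀ : 0 < l₀) (hl₁ : 0 < l₁)
    (hαl : (l₀ + l₁) * (1 / α) = l₀ * (1 / α₀) + l₁ * (1 / α₁))
    (hw : ∀ i, (l₀ + l₁) * w i = l₀ * w₀ i + l₁ * w₁ i) {N₀ N₁ N : Matrix n n ℂ}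
    (hN₀ : N₀ = diagConj U (fun i => e i * Real.exp (w₀ i)))
    (hN₁ : N₁ = diagConj U (fun i => e i * Real.exp (w₁ i)))
    (hN : N = diagConj U (fun i => e i * Real.exp (w i)))
    (hpos : 0 < powTrace α (N * ρ * N)) :
    0 < powTrace α₀ (N₀ * ρ * N₀) ∧ 0 < powTrace α₁ (N₁ * ρ * N₁) ∧
      (l₀ + l₁) * (1 / α * Real.logb 2 (powTrace α (N * ρ * N))) ≤
        l₀ * (1 / α₀ * Real.logb 2 (powTrace α₀ (N₀ * ρ * N₀))) +
          l₁ * (1 / α₁ * Real.logb 2 (powTrace α₁ (N₁ * ρ * N₁))) := by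
  have hl : 0 < l₀ + l₁ := by positivity
  have hα₀' : 0 < α₀ := by linarith
  have hα₁' : 0 < α₁ := by linarith
  have hθ : 1 - l₁ / (l₀ + l₁) = l₀ / (l₀ + l₁) := by field_simp; ring
  have hnn : ∀ (d : n → ℝ) (r : ℝ), 0 ≤ powTrace r (diagConj U d * ρ * diagConj U d) := by
    intro d r
    refine powTrace_nonneg ?_ _
    have := hρ.mul_mul_conjTranspose_same (diagConj U d)
    rwa [diagConj_conjTranspose] at this
  have h := powTrace_interpolation hU hρ e w₀ w₁ w hα₀ hα₁ hα (θ := l₁ / (l₀ + l₁))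
    (by positivity) (by rw [div_le_one hl]; linarith)
    (by rw [hθ]; field_simp; field_simp at hαl; linarith)
    (fun i => by rw [hθ]; field_simp; linarith [hw i]) hN₀ hN₁ hN hpos
  rw [hθ] at h
  have hS₀ : 0 ≤ powTrace α₀ (N₀ * ρ * N₀) := by rw [hN₀]; exact hnn _ _
  have hS₁ : 0 ≤ powTrace α₁ (N₁ * ρ * N₁) := by rw [hN₁]; exact hnn _ _
  have hTpos := Real.rpow_pos_of_pos hpos (1 / (2 * α))
  -- Both weights are positive, so a vanishing endpoint would make the right-hand side vanish.
  have h₀ : 0 < powTrace α₀ (N₀ * ρ * N₀) := by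
    refine lt_of_le_of_ne hS₀ fun h0 => ?_
    rw [← h0, Real.zero_rpow (by positivity), Real.zero_rpow (by positivity), zero_mul] at h
    linarith
  have h₁ : 0 < powTrace α₁ (N₁ * ρ * N₁) := by
    refine lt_of_le_of_ne hS₁ fun h0 => ?_
    rw [← h0, Real.zero_rpow (x := 1 / (2 * α₁)) (by positivity),
      Real.zero_rpow (by positivity), mul_zero] at h
    linarith
  refine ⟨h₀, h₁, ?_⟩
  have hlog := Real.logb_le_logb_of_le (b := 2) (by norm_num) hTpos h
  have hp₀ := Real.rpow_pos_of_pos h₀ (1 / (2 * α₀))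
  have hp₁ := Real.rpow_pos_of_pos h₁ (1 / (2 * α₁))
  rw [Real.logb_mul (Real.rpow_pos_of_pos hp₀ _).ne' (Real.rpow_pos_of_pos hp₁ _).ne',
    Real.logb_rpow_eq_mul_logb_of_pos hpos, Real.logb_rpow_eq_mul_logb_of_pos hp₀,
    Real.logb_rpow_eq_mul_logb_of_pos hp₁, Real.logb_rpow_eq_mul_logb_of_pos h₀,
    Real.logb_rpow_eq_mul_logb_of_pos h₁] at hlog
  have hm := mul_le_mul_of_nonneg_left hlog (by positivity : 0 ≤ 2 * (l₀ + l₁))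
  refine le_trans (le_of_eq ?_) (hm.trans (le_of_eq ?_))
  · field_simp
  · field_simp

end LogConvexity

/-! ### Domination and orthogonality in an eigenbasis -/

section Supports

variable {n : Type*} [Fintype n] [DecidableEq n] {U ρ : Matrix n n ℂ}

theorem dominates_diagConj_iff (hU : U ∈ unitaryGroup n ℂ) (d : n → ℝ) :
    Dominates (diagConj U d) ρ ↔ ∀ p, d p = 0 → ∀ q, (ρ * U) q p = 0 := by
  constructor
  · intro h p hp q
    have h1 : (diagConj U d) *ᵥ (U *ᵥ Pi.single p 1) = 0 := by
      rw [diagConj, mulVec_mulVec, mul_assoc, conjTranspose_mul_of_unitary hU, mul_one,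
        ← mulVec_mulVec]
      have : diagonal (fun i => (d i : ℂ)) *ᵥ Pi.single p 1 = 0 := by
        ext i
        rw [mulVec_diagonal]
        by_cases hi : i = p
        · simp [hi, hp]
        · simp [hi]
      rw [this, mulVec_zero]
    have h2 := congr_fun (h _ h1) q
    rw [mulVec_mulVec] at h2
    simpa using h2
  · intro h v hv
    have h1 : ∀ p, (d p : ℂ) * (Uᴴ *ᵥ v) p = 0 := by
      intro p
      have h2 : Uᴴ *ᵥ (diagConj U d *ᵥ v) = 0 := by rw [hv, mulVec_zero]
      rw [diagConj, mulVec_mulVec, ← mul_assoc, ← mul_assoc, conjTranspose_mul_of_unitary hU,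
        one_mul, ← mulVec_mulVec] at h2
      have := congr_fun h2 p
      rwa [mulVec_diagonal] at this
    have h3 : ρ *ᵥ v = (ρ * U) *ᵥ (Uᴴ *ᵥ v) := by
      rw [mulVec_mulVec, mul_assoc, mul_conjTranspose_of_unitary hU, mul_one]
    rw [h3]
    ext q
    refine Finset.sum_eq_zero fun p _ => ?_
    rcases eq_or_ne (d p) 0 with hp | hp
    · simp [h p hp q]
    · have := (mul_eq_zero.1 (h1 p)).resolve_left (by exact_mod_cast hp)
      simp [this]

theorem perp_diagConj_iff (hU : U ∈ unitaryGroup n ℂ) (d : n → ℝ) :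
    Perp ρ (diagConj U d) ↔ ∀ p, d p ≠ 0 → ∀ q, (ρ * U) q p = 0 := by
  have h1 : Perp ρ (diagConj U d) ↔ ρ * U * diagonal (fun i => (d i : ℂ)) = 0 := by
    rw [Perp, diagConj, ← mul_assoc, ← mul_assoc]
    constructor
    · intro h
      have := congr_arg (· * U) h
      simpa only [mul_assoc, conjTranspose_mul_of_unitary hU, mul_one, zero_mul] using this
    · intro h
      rw [h, zero_mul]
  rw [h1]
  constructor
  · intro h p hp q
    have := congr_fun (congr_fun h q) p
    rw [mul_diagonal] at this
    exact (mul_eq_zero.1 this).resolve_right (by exact_mod_cast hp)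
  · intro h
    ext q p
    rw [mul_diagonal]
    rcases eq_or_ne (d p) 0 with hp | hp
    · simp [hp]
    · simp [h p hp q]

theorem powTrace_pos_of_not_perp (hρ : ρ.PosSemidef) (d : n → ℝ)
    (h : ¬ Perp ρ (diagConj U d)) (α : ℝ) :
    0 < powTrace α (diagConj U d * ρ * diagConj U d) := by
  have hps := hρ.mul_mul_conjTranspose_same (diagConj U d)
  rw [diagConj_conjTranspose] at hps
  refine lt_of_le_of_ne (powTrace_nonneg hps _) fun h0 => h ?_
  have hz := eq_zero_of_powTrace_eq_zero hps h0.symm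
  obtain ⟨W, hW, g, hg, rfl⟩ := hρ.exists_eq_diagConj
  set N := diagConj U d
  set M := diagConj W fun i => √(g i)
  have hM : diagConj W g = M * M := by
    rw [diagConj_mul hW]; simp only [Real.mul_self_sqrt (hg _)]
  have hMN : (M * N)ᴴ * (M * N) = 0 := by
    rw [conjTranspose_mul, diagConj_conjTranspose, diagConj_conjTranspose, ← hz, hM]
    simp only [mul_assoc]
    rfl
  rw [Perp, hM, mul_assoc, conjTranspose_mul_self_eq_zero.1 hMN, mul_zero]

theorem powTrace_one (hρ : ρ.PosSemidef) (hU : U ∈ unitaryGroup n ℂ) (d : n → ℝ) :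
    powTrace 1 (diagConj U d * ρ * diagConj U d) = ∑ p, ((Uᴴ * ρ * U) p p).re * (d p * d p) := by
  have hps := hρ.mul_mul_conjTranspose_same (diagConj U d)
  rw [diagConj_conjTranspose] at hps
  have : powTrace 1 (diagConj U d * ρ * diagConj U d) =
      (diagConj U d * ρ * diagConj U d).trace.re := by
    obtain ⟨W, hW, g, -, hg⟩ := hps.exists_eq_diagConj
    rw [hg, powTrace_diagConj hW, trace_diagConj hW]
    simp
  rw [this, mul_assoc, trace_mul_comm, mul_assoc, diagConj_mul hU, trace_mul_diagConj]

end Supports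

/-! ### The partial trace -/

section PartialTrace

variable {a b : Type*} [Fintype a] [Fintype b] [DecidableEq b]

theorem trace_partialTraceRight_mul (ρ : Matrix (a × b) (a × b) ℂ) (X : Matrix a a ℂ) :
    (partialTraceRight ρ * X).trace = (ρ * (X ⊗ₖ (1 : Matrix b b ℂ))).trace := by
  simp only [trace, diag_apply, mul_apply, partialTraceRight, of_apply, kronecker_apply,
    Fintype.sum_prod_type, one_apply, Finset.sum_mul]
  refine Finset.sum_congr rfl fun i _ => ?_
  rw [Finset.sum_comm]
  refine Finset.sum_congr rfl fun k _ => ?_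
  refine Finset.sum_congr rfl fun j _ => ?_
  simp

end PartialTrace

/-! ### Relations between the orders and the case of order one -/

section RealArithmetic

/-- The hypothesis on the orders, in terms of `1 / α' = 1 - 1 / α`; it reads `α' = β' + γ'`. -/
theorem one_sub_inv_relation {α β γ : ℝ} (hα : α ≠ 0) (hβ : β ≠ 0) (hγ : γ ≠ 0)
    (hrel : α * β * γ - 2 * β * γ - α + β + γ = 0) :
    (1 - 1 / α) * ((1 - 1 / β) + (1 - 1 / γ)) = (1 - 1 / β) * (1 - 1 / γ) := by
  field_simp
  linear_combination hrel

/-- Jensen's inequality for the logarithm, which is the chain rule of order one. The sign of `c` is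
arbitrary. -/
theorem mul_sum_logb_le {n : Type*} [Fintype n] {r s : n → ℝ} (hr : ∀ p, 0 ≤ r p)
    (hr1 : ∑ p, r p = 1) (hs : ∀ p, 0 < s p) (c : ℝ) :
    c * ∑ p, r p * Real.logb 2 (s p) ≤ Real.logb 2 (∑ p, r p * s p ^ c) := by
  have h := strictConcaveOn_log_Ioi.concaveOn.le_map_sum (t := Finset.univ) (w := r)
    (p := fun p => s p ^ c) (fun p _ => hr p) hr1 (fun p _ => Real.rpow_pos_of_pos (hs p) c)
  simp only [smul_eq_mul] at h
  have h2 : 0 < Real.log 2 := Real.log_pos (by norm_num)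
  have h3 := div_le_div_of_nonneg_right h h2.le
  refine le_trans (le_of_eq ?_) h3
  rw [Finset.mul_sum, Finset.sum_div]
  refine Finset.sum_congr rfl fun p _ => ?_
  rw [Real.log_rpow (hs p), Real.logb]
  ring

end RealArithmetic

/-! ### The chain rule -/

section ChainRule

variable {n : Type*} [Fintype n] [DecidableEq n]

/-- The chain rule of orders different from one in a common eigenbasis `U` of `1 ⊗ τ` and `σ ⊗ 1`,
with eigenvalues `t` and `s`. -/
theorem chainRule_diagConj {U ρ : Matrix n n ℂ} (hU : U ∈ unitaryGroup n ℂ) (hρ : ρ.PosSemidef)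
    {s t : n → ℝ} (hs : ∀ p, 0 < s p) (ht : ∀ p, 0 ≤ t p) {α β γ : ℝ}
    (hα : 1 / 2 ≤ α) (hβ : 1 / 2 ≤ β) (hγ0 : γ ≠ 0) (hγ1 : γ ≠ 1) (hα1 : α ≠ 1) (hβ1 : β ≠ 1)
    (hrel : α * β * γ - 2 * β * γ - α + β + γ = 0)
    (hsupp : (α < 1 ∧ β < 1) ∨ ∀ p, t p = 0 → ((Uᴴ * ρ * U) p p).re = 0)
    {A B : Matrix n n ℂ} (hA : A = diagConj U (fun p => t p ^ ((1 - α) / (2 * α))))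
    (hB : B = diagConj U (fun p => (s p * t p) ^ ((1 - β) / (2 * β)))) {T : ℝ}
    (hT : T = ∑ p, ((Uᴴ * ρ * U) p p).re * s p ^ (1 / conj γ))
    (hApos : 0 < powTrace α (A * ρ * A)) (hBpos : 0 < powTrace β (B * ρ * B)) (hTpos : 0 < T) :
    (1 / β + 1 / γ ≤ 2 →
      1 / (α - 1) * Real.logb 2 (powTrace α (A * ρ * A)) ≤
        1 / (β - 1) * Real.logb 2 (powTrace β (B * ρ * B)) + conj γ * Real.logb 2 T) ∧
    (2 ≤ 1 / β + 1 / γ →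
      1 / (β - 1) * Real.logb 2 (powTrace β (B * ρ * B)) + conj γ * Real.logb 2 T ≤
        1 / (α - 1) * Real.logb 2 (powTrace α (A * ρ * A))) := by
  have hα0 : 0 < α := by linarith
  have hβ0 : 0 < β := by linarith
  have hα1' : α - 1 ≠ 0 := sub_ne_zero.2 hα1
  have hβ1' : β - 1 ≠ 0 := sub_ne_zero.2 hβ1
  have hγ1' : γ - 1 ≠ 0 := sub_ne_zero.2 hγ1
  have hr : ∀ p, 0 ≤ ((Uᴴ * ρ * U) p p).re := fun p =>
    (Complex.le_def.1 (hρ.conjTranspose_mul_mul_same U).diag_nonneg).1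
  -- In terms of `x = 1 - 1 / α`, `y = 1 - 1 / β`, `z = 1 - 1 / γ` the hypothesis on the orders is
  -- `1 / x = 1 / y + 1 / z`.
  obtain ⟨x, hx⟩ : ∃ x, x = 1 - 1 / α := ⟨_, rfl⟩
  obtain ⟨y, hy⟩ : ∃ y, y = 1 - 1 / β := ⟨_, rfl⟩
  obtain ⟨z, hz⟩ : ∃ z, z = 1 - 1 / γ := ⟨_, rfl⟩
  have hxyz : x * (y + z) = y * z := by
    rw [hx, hy, hz]; exact one_sub_inv_relation hα0.ne' hβ0.ne' hγ0 hrel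
  have hx0 : x ≠ 0 := by
    rw [hx, show 1 - 1 / α = (α - 1) / α by field_simp]; exact div_ne_zero hα1' hα0.ne'
  have hy0 : y ≠ 0 := by
    rw [hy, show 1 - 1 / β = (β - 1) / β by field_simp]; exact div_ne_zero hβ1' hβ0.ne'
  have hz0 : z ≠ 0 := by
    rw [hz, show 1 - 1 / γ = (γ - 1) / γ by field_simp]; exact div_ne_zero hγ1' hγ0
  have hinv : 1 / x = 1 / y + 1 / z := by
    field_simp
    linarith
  have hαx : 1 / α = 1 - x := by rw [hx]; ring
  have hβy : 1 / β = 1 - y := by rw [hy]; ring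
  have hα_sub : 1 / (α - 1) = 1 / x * (1 / α) := by
    rw [hx]; field_simp
  have hβ_sub : 1 / (β - 1) = 1 / y * (1 / β) := by
    rw [hy]; field_simp
  have hγ_conj : conj γ = 1 / z := by
    rw [hz, conj]; field_simp
  have hγ_inv : 1 / conj γ = z := by rw [hγ_conj, one_div_one_div]
  have hxneg : α < 1 → x < 0 := fun h => by
    rw [hx, sub_neg, lt_div_iff₀ hα0]; linarith
  have hyneg : β < 1 → y < 0 := fun h => by
    rw [hy, sub_neg, lt_div_iff₀ hβ0]; linarith
  have hαexp : (1 - α) / (2 * α) = -x / 2 := by rw [hx]; field_simp; ring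
  have hβexp : (1 - β) / (2 * β) = -y / 2 := by rw [hy]; field_simp; ring
  -- The three weights `A`, `B`, `C`, restricted to the support of `t`, lie on one log-linear line.
  let e : n → ℝ := fun p => if t p = 0 then 0 else 1
  have hA' : A = diagConj U (fun p => e p * Real.exp (-x / 2 * Real.log (t p))) := by
    rw [hA, hαexp]
    congr 1
    ext p
    simp only [e]
    split_ifs with h
    · rw [h, Real.zero_rpow (by simp [hx0]), zero_mul]
    · rw [Real.rpow_def_of_pos (lt_of_le_of_ne (ht p) (Ne.symm h)), one_mul, mul_comm]
  have hB' : B = diagConj U (fun p => e p *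
      Real.exp (-y / 2 * (Real.log (s p) + Real.log (t p)))) := by
    rw [hB, hβexp]
    congr 1
    ext p
    simp only [e]
    split_ifs with h
    · rw [h, mul_zero, Real.zero_rpow (by simp [hy0]), zero_mul]
    · have htp : 0 < t p := lt_of_le_of_ne (ht p) (Ne.symm h)
      rw [Real.rpow_def_of_pos (mul_pos (hs p) htp), one_mul, mul_comm,
        Real.log_mul (hs p).ne' htp.ne']
  obtain ⟨C, hC⟩ : ∃ C, C = diagConj U (fun p => e p * Real.exp (z / 2 * Real.log (s p))) :=
    ⟨_, rfl⟩
  have hCC : powTrace 1 (C * ρ * C) = ∑ p, ((Uᴴ * ρ * U) p p).re * (e p * s p ^ z) := by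
    rw [hC, powTrace_one hρ hU]
    refine Finset.sum_congr rfl fun p _ => ?_
    have he : e p * e p = e p := by simp only [e]; split_ifs <;> simp
    rw [mul_mul_mul_comm, he, ← Real.exp_add, Real.rpow_def_of_pos (hs p)]
    congr 3
    ring
  rw [hγ_inv] at hT
  have hCT : powTrace 1 (C * ρ * C) ≤ T := by
    rw [hCC, hT]
    refine Finset.sum_le_sum fun p _ => mul_le_mul_of_nonneg_left ?_ (hr p)
    have := Real.rpow_nonneg (hs p).le z
    simp only [e]
    split_ifs
    · simpa using this
    · simp
  have hCT' : (∀ p, t p = 0 → ((Uᴴ * ρ * U) p p).re = 0) → powTrace 1 (C * ρ * C) = T := by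
    intro h
    rw [hCC, hT]
    refine Finset.sum_congr rfl fun p _ => ?_
    by_cases hp : t p = 0
    · rw [h p hp, zero_mul, zero_mul]
    · simp [e, hp]
  rw [hα_sub, hβ_sub, hγ_conj, mul_assoc (1 / x), mul_assoc (1 / y)]
  have h21 : (1 : ℝ) / 2 ≤ 1 := by norm_num
  -- Each of the three weights in turn is the intermediate one. The sign `k` makes the two
  -- coefficients positive.
  have midA : ∀ k : ℝ, 0 < k / y → 0 < k / z →
      k * (1 / x * (1 / α * Real.logb 2 (powTrace α (A * ρ * A)))) ≤
      k * (1 / y * (1 / β * Real.logb 2 (powTrace β (B * ρ * B))) + 1 / z * Real.logb 2 T) := by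
    intro k h0 h1
    have hk : k / y + k / z = k / x := by
      rw [div_eq_mul_one_div k x, hinv]; ring
    obtain ⟨-, hC0, h⟩ := logb_powTrace_interpolation hU hρ e
      (fun p => -y / 2 * (Real.log (s p) + Real.log (t p)))
      (fun p => z / 2 * Real.log (s p)) (fun p => -x / 2 * Real.log (t p))
      hβ h21 hα0 h0 h1
      (by
        rw [hk, hαx, hβy]
        have : k / x * (1 - x) = (k / y + k / z) - k := by rw [hk]; field_simp
        rw [this]; field_simp; ring)
      (fun p => by rw [hk]; field_simp; ring) hB' hC hA' hApos
    have hlog := Real.logb_le_logb_of_le (b := 2) (by norm_num) hC0 hCT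
    have := mul_le_mul_of_nonneg_left hlog h1.le
    rw [hk] at h
    calc _ = k / x * (1 / α * Real.logb 2 (powTrace α (A * ρ * A))) := by ring
      _ ≤ _ := h
      _ ≤ k / y * (1 / β * Real.logb 2 (powTrace β (B * ρ * B))) + k / z * Real.logb 2 T := by
        rw [one_div_one, one_mul]; linarith
      _ = _ := by ring
  have midB : ∀ k : ℝ, 0 < k / x → 0 < -k / z →
      k * (1 / y * (1 / β * Real.logb 2 (powTrace β (B * ρ * B))) + 1 / z * Real.logb 2 T) ≤
      k * (1 / x * (1 / α * Real.logb 2 (powTrace α (A * ρ * A)))) := by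
    intro k h0 h1
    have hk : k / x + -k / z = k / y := by
      rw [div_eq_mul_one_div k x, hinv]; ring
    obtain ⟨-, hC0, h⟩ := logb_powTrace_interpolation hU hρ e
      (fun p => -x / 2 * Real.log (t p))
      (fun p => z / 2 * Real.log (s p)) (fun p => -y / 2 * (Real.log (s p) + Real.log (t p)))
      hα h21 hβ0 h0 h1
      (by
        rw [hk, hαx, hβy]
        have : k / y * (1 - y) = (k / x + -k / z) - k := by rw [hk]; field_simp
        rw [this]; field_simp; ring)
      (fun p => by rw [hk]; field_simp; ring) hA' hC hB' hBpos
    have hlog := Real.logb_le_logb_of_le (b := 2) (by norm_num) hC0 hCT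
    have := mul_le_mul_of_nonneg_left hlog h1.le
    rw [hk] at h
    have h' : k / y * (1 / β * Real.logb 2 (powTrace β (B * ρ * B))) ≤
        k / x * (1 / α * Real.logb 2 (powTrace α (A * ρ * A))) + -k / z * Real.logb 2 T := by
      refine h.trans ?_
      rw [one_div_one, one_mul]; linarith
    have e1 : k * (1 / y * (1 / β * Real.logb 2 (powTrace β (B * ρ * B))) +
        1 / z * Real.logb 2 T) = k / y * (1 / β * Real.logb 2 (powTrace β (B * ρ * B))) -
          -k / z * Real.logb 2 T := by ring
    have e2 : k * (1 / x * (1 / α * Real.logb 2 (powTrace α (A * ρ * A)))) =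
        k / x * (1 / α * Real.logb 2 (powTrace α (A * ρ * A))) := by ring
    rw [e1, e2]
    linarith
  have midC : ∀ k : ℝ, (∀ p, t p = 0 → ((Uᴴ * ρ * U) p p).re = 0) → 0 < k / x → 0 < -k / y →
      k * (1 / y * (1 / β * Real.logb 2 (powTrace β (B * ρ * B))) + 1 / z * Real.logb 2 T) ≤
      k * (1 / x * (1 / α * Real.logb 2 (powTrace α (A * ρ * A)))) := by
    intro k hdom h0 h1
    have hk : k / x + -k / y = k / z := by
      rw [div_eq_mul_one_div k x, hinv]; ring
    obtain ⟨-, -, h⟩ := logb_powTrace_interpolation hU hρ e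
      (fun p => -x / 2 * Real.log (t p)) (fun p => -y / 2 * (Real.log (s p) + Real.log (t p)))
      (fun p => z / 2 * Real.log (s p))
      hα hβ one_pos h0 h1
      (by rw [hαx, hβy]; field_simp; ring)
      (fun p => by rw [hk]; field_simp; ring) hA' hB' hC (by rw [hCT' hdom]; exact hTpos)
    rw [hk, hCT' hdom, one_div_one, one_mul] at h
    have e1 : k * (1 / y * (1 / β * Real.logb 2 (powTrace β (B * ρ * B))) +
        1 / z * Real.logb 2 T) = k / z * Real.logb 2 T -
          -k / y * (1 / β * Real.logb 2 (powTrace β (B * ρ * B))) := by ring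
    have e2 : k * (1 / x * (1 / α * Real.logb 2 (powTrace α (A * ρ * A)))) =
        k / x * (1 / α * Real.logb 2 (powTrace α (A * ρ * A))) := by ring
    rw [e1, e2]
    linarith
  have hyz : 1 / β + 1 / γ = 2 - (y + z) := by rw [hy, hz]; ring
  rw [hyz]
  have hyz0 : y + z ≠ 0 := fun h => by
    rw [h, mul_zero] at hxyz
    exact mul_ne_zero hy0 hz0 hxyz.symm
  have hxval : x = y * z / (y + z) := by rw [← hxyz]; field_simp
  constructor
  · intro h
    have hpos : 0 < y + z := lt_of_le_of_ne (by linarith) hyz0.symm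
    rcases lt_or_gt_of_ne hy0 with hyn | hyp
    · have hzp : 0 < z := by linarith
      have hxn : x < 0 := by
        rw [hxval]; exact div_neg_of_neg_of_pos (mul_neg_of_neg_of_pos hyn hzp) hpos
      have := midB (-1) (div_pos_of_neg_of_neg (by norm_num) hxn) (by rw [neg_neg]; positivity)
      linarith
    · rcases lt_or_gt_of_ne hz0 with hzn | hzp
      · have hxn : x < 0 := by
          rw [hxval]; exact div_neg_of_neg_of_pos (mul_neg_of_pos_of_neg hyp hzn) hpos
        have hdom := hsupp.resolve_left fun h => by linarith [hyneg h.2]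
        have := midC (-1) hdom (div_pos_of_neg_of_neg (by norm_num) hxn)
          (by rw [neg_neg]; positivity)
        linarith
      · have := midA 1 (by positivity) (by positivity)
        linarith
  · intro h
    have hneg : y + z < 0 := lt_of_le_of_ne (by linarith) hyz0
    rcases lt_or_gt_of_ne hy0 with hyn | hyp
    · rcases lt_or_gt_of_ne hz0 with hzn | hzp
      · have := midA (-1) (div_pos_of_neg_of_neg (by norm_num) hyn)
          (div_pos_of_neg_of_neg (by norm_num) hzn)
        linarith
      · have hxp : 0 < x := by
          rw [hxval]; exact div_pos_of_neg_of_neg (mul_neg_of_neg_of_pos hyn hzp) hneg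
        have hdom := hsupp.resolve_left fun h => by linarith [hxneg h.1]
        have := midC 1 hdom (by positivity) (div_pos_of_neg_of_neg (by norm_num) hyn)
        linarith
    · have hzn : z < 0 := by linarith
      have hxp : 0 < x := by
        rw [hxval]; exact div_pos_of_neg_of_neg (mul_neg_of_pos_of_neg hyp hzn) hneg
      have := midB 1 (by positivity) (div_pos_of_neg_of_neg (by norm_num) hzn)
      linarith

end ChainRule

end Quantum

open Quantum Matrix

theorem theorem3p1 {a b : Type*} [Fintype a] [Fintype b] [DecidableEq a] [DecidableEq b]
    (α β γ : ℝ) (hα : 1 / 2 ≤ α) (hβ : 1 / 2 ≤ β) (hγ0 : γ ≠ 0) (hγ1 : γ ≠ 1)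
    (hrel : α * β * γ - 2 * β * γ - α + β + γ = 0)
    (ρ : Matrix (a × b) (a × b) ℂ) (hρ : Quantum.IsDensity ρ)
    (σ : Matrix a a ℂ) (hσ : σ.PosDef) (τ : Matrix b b ℂ) (hτ : τ.PosSemidef)
    (hsupp : (α < 1 ∧ β < 1) ∨ Quantum.Dominates ((1 : Matrix a a ℂ) ⊗ₖ τ) ρ) :
    (1 / β + 1 / γ ≤ 2 →
      -Quantum.condRenyi α ρ τ ≤ Quantum.renyiDiv β ρ (σ ⊗ₖ τ) +
        ((Real.logb 2 ((Quantum.partialTraceRight ρ *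
            Quantum.mpow σ (1 / Quantum.conj γ)).trace.re ^ Quantum.conj γ) : ℝ) : EReal)) ∧
    (2 ≤ 1 / β + 1 / γ →
      Quantum.renyiDiv β ρ (σ ⊗ₖ τ) +
        ((Real.logb 2 ((Quantum.partialTraceRight ρ *
            Quantum.mpow σ (1 / Quantum.conj γ)).trace.re ^ Quantum.conj γ) : ℝ) : EReal) ≤
      -Quantum.condRenyi α ρ τ) := by
  obtain ⟨hρ, hρ1⟩ := hρ
  obtain ⟨V, hV, s, hs, rfl⟩ := hσ.exists_eq_diagConj
  obtain ⟨W, hW, t, ht, rfl⟩ := hτ.exists_eq_diagConj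
  have hα0 : 0 < α := by linarith
  have hβ0 : 0 < β := by linarith
  have hγ1' : γ - 1 ≠ 0 := sub_ne_zero.2 hγ1
  -- All operators on the tensor product are diagonal in the basis `U = V ⊗ W`.
  obtain ⟨U, hUdef⟩ : ∃ U, U = V ⊗ₖ W := ⟨_, rfl⟩
  have hU : U ∈ unitaryGroup (a × b) ℂ := by rw [hUdef]; exact Matrix.kronecker_mem_unitary hV hW
  have h1τ : (1 : Matrix a a ℂ) ⊗ₖ diagConj W t = diagConj U (fun p => t p.2) := by
    rw [one_eq_diagConj hV, diagConj_kronecker, hUdef]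
    simp only [one_mul]
  have hστ : diagConj V s ⊗ₖ diagConj W t = diagConj U (fun p => s p.1 * t p.2) := by
    rw [diagConj_kronecker, hUdef]
  obtain ⟨r, hrdef⟩ : ∃ r : a × b → ℝ, ∀ p, r p = ((Uᴴ * ρ * U) p p).re := ⟨_, fun _ => rfl⟩
  have hr : ∀ p, 0 ≤ r p := fun p => by
    rw [hrdef]
    exact (Complex.le_def.1 (hρ.conjTranspose_mul_mul_same U).diag_nonneg).1
  have hr1 : ∑ p, r p = 1 := by
    have h := trace_mul_diagConj ρ U (fun _ => 1)
    rw [← one_eq_diagConj hU, mul_one, hρ1] at h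
    simpa [hrdef] using h.symm
  have hT : (partialTraceRight ρ * mpow (diagConj V s) (1 / conj γ)).trace.re =
      ∑ p, r p * s p.1 ^ (1 / conj γ) := by
    rw [trace_partialTraceRight_mul, mpow_diagConj hV, one_eq_diagConj hW, diagConj_kronecker,
      ← hUdef, trace_mul_diagConj]
    simp only [mul_one, hrdef]
  have hTpos : 0 < ∑ p, r p * s p.1 ^ (1 / conj γ) := by
    have hspos : ∀ p : a × b, 0 < s p.1 ^ (1 / conj γ) := fun p => Real.rpow_pos_of_pos (hs _) _
    refine lt_of_le_of_ne (Finset.sum_nonneg fun p _ => mul_nonneg (hr p) (hspos p).le) fun h => ?_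
    have hz := (Finset.sum_eq_zero_iff_of_nonneg
      fun p _ => mul_nonneg (hr p) (hspos p).le).1 h.symm
    have : ∑ p, r p = 0 := Finset.sum_eq_zero fun p hp =>
      (mul_eq_zero.1 (hz p hp)).resolve_right (hspos p).ne'
    linarith
  have hdom_iff : Dominates (diagConj U fun p => s p.1 * t p.2) ρ ↔
      Dominates (diagConj U fun p => t p.2) ρ := by
    rw [dominates_diagConj_iff hU, dominates_diagConj_iff hU]
    simp only [mul_eq_zero, (hs _).ne', false_or]
  have hperp_iff : Perp ρ (diagConj U fun p => s p.1 * t p.2) ↔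
      Perp ρ (diagConj U fun p => t p.2) := by
    rw [perp_diagConj_iff hU, perp_diagConj_iff hU]
    simp only [ne_eq, mul_eq_zero, (hs _).ne', false_or]
  have hdom_r : Dominates (diagConj U fun p => t p.2) ρ → ∀ p, t p.2 = 0 → r p = 0 := by
    intro h p hp
    rw [hrdef, mul_assoc, mul_apply]
    simp only [(dominates_diagConj_iff hU _).1 h p hp, mul_zero, Finset.sum_const_zero,
      Complex.zero_re]
  rw [condRenyi, neg_neg, hT, Real.logb_rpow_eq_mul_logb_of_pos hTpos, h1τ, hστ]
  rw [h1τ] at hsupp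
  by_cases hα1 : α = 1
  · -- The hypothesis on the orders then forces `β = 1`.
    have hβ1 : β = 1 := by
      rw [hα1] at hrel
      have : (γ - 1) * (1 - β) = 0 := by linear_combination hrel
      have := (mul_eq_zero.1 this).resolve_left hγ1'
      linarith
    have hdom := hsupp.resolve_left fun h => by linarith [h.1]
    rw [renyiDiv, renyiDiv, if_pos hα1, if_pos hβ1, relEntropy, relEntropy, if_pos hdom,
      if_pos (hdom_iff.2 hdom), ← EReal.coe_add, EReal.coe_le_coe_iff, EReal.coe_le_coe_iff]
    have hD : (ρ * (mlog ρ - mlog (diagConj U fun p => t p.2))).trace.re =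
        (ρ * (mlog ρ - mlog (diagConj U fun p => s p.1 * t p.2))).trace.re +
          ∑ p, r p * Real.logb 2 (s p.1) := by
      rw [mul_sub, mul_sub, trace_sub, trace_sub, Complex.sub_re, Complex.sub_re,
        mlog_diagConj hU, mlog_diagConj hU, trace_mul_diagConj, trace_mul_diagConj]
      have : ∑ p, ((Uᴴ * ρ * U) p p).re * Real.logb 2 (s p.1 * t p.2) =
          ∑ p, ((Uᴴ * ρ * U) p p).re * Real.logb 2 (t p.2) +
            ∑ p, r p * Real.logb 2 (s p.1) := by
        rw [← Finset.sum_add_distrib]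
        refine Finset.sum_congr rfl fun p _ => ?_
        rw [← hrdef]
        by_cases hp : t p.2 = 0
        · rw [hdom_r hdom p hp]; ring
        · rw [Real.logb_mul (hs _).ne' hp]; ring
      rw [this]
      ring
    have hJ := mul_sum_logb_le hr hr1 (fun p : a × b => hs p.1) (1 / conj γ)
    have hc : 1 / conj γ = 1 - 1 / γ := by rw [conj]; field_simp
    have hconj : conj γ * (1 / conj γ) = 1 := by
      rw [conj]; field_simp
    rw [hD]
    have hJ' : ∑ p, r p * Real.logb 2 (s p.1) =
        conj γ * (1 / conj γ * ∑ p, r p * Real.logb 2 (s p.1)) := by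
      rw [← mul_assoc, hconj, one_mul]
    refine ⟨fun h => ?_, fun h => ?_⟩
    · have hcn : 0 ≤ conj γ := by
        rw [← one_div_nonneg, hc]; rw [hβ1] at h; linarith
      have := mul_le_mul_of_nonneg_left hJ hcn
      linarith
    · have hcn : conj γ ≤ 0 := by
        rw [← one_div_nonpos, hc]; rw [hβ1] at h; linarith
      have := mul_le_mul_of_nonpos_left hJ hcn
      linarith
  · have hβ1 : β ≠ 1 := by
      rintro rfl
      have : (γ - 1) * (α - 1) = 0 := by linear_combination hrel
      exact hα1 (by linarith [(mul_eq_zero.1 this).resolve_left hγ1'])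
    by_cases hperp : Perp ρ (diagConj U fun p => t p.2)
    · have hβtop : renyiDiv β ρ (diagConj U fun p => s p.1 * t p.2) = ⊤ := by
        rw [renyiDiv, if_neg hβ1, if_neg fun h => h.1 (hperp_iff.2 hperp)]
      have hαtop : renyiDiv α ρ (diagConj U fun p => t p.2) = ⊤ := by
        rw [renyiDiv, if_neg hα1, if_neg fun h => h.1 hperp]
      rw [hβtop, hαtop, EReal.top_add_coe]
      exact ⟨fun _ => le_rfl, fun _ => le_rfl⟩
    · have hαfin : ¬ Perp ρ (diagConj U fun p => t p.2) ∧
          (Dominates (diagConj U fun p => t p.2) ρ ∨ α < 1) :=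
        ⟨hperp, hsupp.elim (fun h => Or.inr h.1) Or.inl⟩
      have hβfin : ¬ Perp ρ (diagConj U fun p => s p.1 * t p.2) ∧
          (Dominates (diagConj U fun p => s p.1 * t p.2) ρ ∨ β < 1) :=
        ⟨fun h => hperp (hperp_iff.1 h),
          hsupp.elim (fun h => Or.inr h.2) fun h => Or.inl (hdom_iff.2 h)⟩
      rw [renyiDiv, renyiDiv, if_neg hα1, if_neg hβ1, if_pos hαfin, if_pos hβfin,
        ← EReal.coe_add, EReal.coe_le_coe_iff, EReal.coe_le_coe_iff,
        mpow_diagConj hU, mpow_diagConj hU]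
      -- A power of a nonnegative number vanishes only with its base, so powers keep the support.
      have hperp_rpow : ∀ (d : a × b → ℝ) (x : ℝ), (∀ p, 0 ≤ d p) →
          ¬ Perp ρ (diagConj U d) → ¬ Perp ρ (diagConj U fun p => d p ^ x) := by
        intro d x hd h h'
        rw [perp_diagConj_iff hU] at h h'
        exact h fun p hp => h' p
          (Real.rpow_pos_of_pos (lt_of_le_of_ne (hd p) (Ne.symm hp)) x).ne'
      exact chainRule_diagConj hU hρ (fun p => hs p.1) (fun p => ht p.2) hα hβ hγ0 hγ1 hα1 hβ1 hrel
        (hsupp.imp_right fun h p hp => by rw [← hrdef]; exact hdom_r h p hp) rfl rfl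
        (by simp only [hrdef])
        (powTrace_pos_of_not_perp hρ _ (hperp_rpow _ _ (fun p => ht p.2) hαfin.1) α)
        (powTrace_pos_of_not_perp hρ _
          (hperp_rpow _ _ (fun p => mul_nonneg (hs p.1).le (ht p.2)) hβfin.1) β) hTpos
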